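/- Let $(\mathbb{E},\circ,\bullet)$ be a Euclidean Jordan algebra of dimension $n$: an $n$-dimensional real inner product space with inner product $\bullet$ and a commutative bilinear product $\circ$ with identity element $e$ such that $x\circ((x\circ x)\circ y)=(x\circ x)\circ(x\circ y)$ and $(x\circ y)\bullet z=x\bullet(y\circ z)$ for all $x,y,z\in\mathbb{E}$. Let $\mathbb{E}_+=\{x\circ x\mid x\in\mathbb{E}\}$ be its symmetric cone and let $\mathrm{rk}$ be its rank, i.e. the maximal degree of the minimal polynomial of an element of $\mathbb{E}$. An ordered Jordan frame is a tuple $(c_1,\dots,c_{\mathrm{rk}})$ of primitive idempotents (nonzero elements with $c\circ c=c$ that are not the sum of two nonzero idempotents) with $c_i\circ c_j=0$ for $i\ne j$ and $\sum_i c_i=e$; let $\mathfrak{F}(\mathbb{E})$ be the set of all of them, let $\mathfrak{F}_{\mathrm c}(\mathbb{E})\subseteq\mathfrak{F}(\mathbb{E})$ be a complete set of representatives of its orbits under permutation of the entries, and fix a set $\mathfrak{F}$ with $\mathfrak{F}_{\mathrm c}(\mathbb{E})\subseteq\mathfrak{F}\subseteq\mathfrak{F}(\mathbb{E})$. Let $\mathcal{S}^{n,2}(\mathbb{E})\subseteq\mathbb{E}\otimes\mathbb{E}$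 be the space of symmetric tensors of order two, with the inner product $\langle\cdot,\cdot\rangle$ induced by $\langle x\otimes y,x'\otimes y'\rangle=(x\bullet x')(y\bullet y')$, and let $$\mathcal{COP}^{n,2}(\mathbb{E}_+)=\{\mathcal{A}\in\mathcal{S}^{n,2}(\mathbb{E})\mid\langle\mathcal{A},x\otimes x\rangle\ge 0\text{ for all }x\in\mathbb{E}_+\}.$$ For $\mathcal{A}\in\mathcal{S}^{n,2}(\mathbb{E})$ and $(c_1,\dots,c_{\mathrm{rk}})\in\mathfrak{F}(\mathbb{E})$ let $\mathcal{A}(c_1,\dots,c_{\mathrm{rk}})$ be the symmetric matrix with entries $\langle\mathcal{A},c_i\otimes c_j\rangle$. For $r\in\mathbb{N}=\{0,1,2,\dots\}$ let $\mathcal{I}^{\mathrm{rk}}_{\mathrm{dP},r}$ be the set of real symmetric $\mathrm{rk}\times\mathrm{rk}$ matrices $A$ such that the polynomial $(x_1+\dots+x_{\mathrm{rk}})^r\,x^{\top}Ax$ has only nonnegative coefficients, and let $$\mathcal{I}^{n}_{\mathrm{dP},r}(\mathbb{E}_+)=\bigcap_{(c_1,\dots,c_{\mathrm{rk}})\in\mathfrak{F}}\{\mathcal{A}\in\mathcal{S}^{n,2}(\mathbb{E})\mid\mathcal{A}(c_1,\dots,c_{\mathrm{rk}})\in\mathcal{I}^{\mathrm{rk}}_{\mathrm{dP},r}\}.$$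 Then each $\mathcal{I}^{n}_{\mathrm{dP},r}(\mathbb{E}_+)$ is a closed convex cone in $\mathcal{S}^{n,2}(\mathbb{E})$ (a cone being a nonempty set closed under multiplication by positive reals), and 1. $\mathcal{I}^{n}_{\mathrm{dP},r}(\mathbb{E}_+)\subseteq\mathcal{I}^{n}_{\mathrm{dP},r+1}(\mathbb{E}_+)\subseteq\mathcal{COP}^{n,2}(\mathbb{E}_+)$ for all $r\in\mathbb{N}$; 2. $\operatorname{int}\mathcal{COP}^{n,2}(\mathbb{E}_+)\subseteq\bigcup_{r=0}^{\infty}\mathcal{I}^{n}_{\mathrm{dP},r}(\mathbb{E}_+)$, the interior being taken in $\mathcal{S}^{n,2}(\mathbb{E})$. -/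

import Mathlib

open scoped TensorProduct

noncomputable section

/-- A Euclidean Jordan algebra structure on a real inner product space `E` (which is
taken finite-dimensional wherever the structure is used): a commutative bilinear product satisfying
the Jordan identity, with an identity element, for which the inner product of `E` is associative. -/
structure EuclideanJordanAlgebra (E : Type*) [NormedAddCommGroup E] [InnerProductSpace ℝ E] where
  /-- the Jordan product -/
  mul : E →ₗ[ℝ] E →ₗ[ℝ] E
  /-- the identity element -/
  one : E
  mul_comm : ∀ x y, mul x y = mul y x
  jordan : ∀ x y, mul x (mul (mul x x) y) = mul (mul x x) (mul x y)
  one_mul : ∀ x, mul one x = x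
  inner_mul_left : ∀ x y z, inner ℝ (mul x y) z = inner ℝ x (mul y z)

namespace EuclideanJordanAlgebra

variable {E : Type*} [NormedAddCommGroup E] [InnerProductSpace ℝ E]

/-- Powers `x ^ k` with respect to the Jordan product, `x ^ 0` being the identity element. -/
def pow (J : EuclideanJordanAlgebra E) (x : E) : ℕ → E
  | 0 => J.one
  | k + 1 => J.mul x (J.pow x k)

/-- The degree of the minimal polynomial of `x`: the least `k` such that `1, x, …, x ^ k` are
linearly dependent. -/
def degree (J : EuclideanJordanAlgebra E) (x : E) : ℕ :=
  sInf {k : ℕ | ¬ LinearIndependent ℝ (fun i : Fin (k + 1) => J.pow x i)}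

/-- The rank: the maximal degree of the minimal polynomial of an element. In finite dimension
the degrees are bounded by the dimension, so that the supremum is attained. -/
def rank (J : EuclideanJordanAlgebra E) : ℕ := ⨆ x : E, J.degree x

/-- `c` is an idempotent. -/
def IsIdempotent (J : EuclideanJordanAlgebra E) (c : E) : Prop := J.mul c c = c

/-- A primitive idempotent: nonzero and not the sum of two nonzero idempotents. -/
def IsPrimitive (J : EuclideanJordanAlgebra E) (c : E) : Prop :=
  J.IsIdempotent c ∧ c ≠ 0 ∧
    ¬ ∃ a b : E, J.IsIdempotent a ∧ J.IsIdempotent b ∧ a ≠ 0 ∧ b ≠ 0 ∧ c = a + b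

/-- A Jordan frame: a complete system of pairwise orthogonal primitive idempotents. -/
def IsJordanFrame (J : EuclideanJordanAlgebra E) {k : ℕ} (c : Fin k → E) : Prop :=
  (∀ i, J.IsPrimitive (c i)) ∧ (∀ i j, i ≠ j → J.mul (c i) (c j) = 0) ∧ ∑ i, c i = J.one

/-- The set of ordered Jordan frames, as a subset of `E ^ rank`. -/
def orderedFrames (J : EuclideanJordanAlgebra E) : Set (Fin J.rank → E) :=
  {c | J.IsJordanFrame c}

/-- `R` is a complete set of representatives of the orbits of the ordered Jordan frames under
permutation of the entries: it contains exactly one reordering of each ordered Jordan frame. -/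
def IsCompleteSetOfFrames (J : EuclideanJordanAlgebra E) (R : Set (Fin J.rank → E)) : Prop :=
  R ⊆ J.orderedFrames ∧
    ∀ c ∈ J.orderedFrames, ∃! d, d ∈ R ∧ ∃ σ : Equiv.Perm (Fin J.rank), d = c ∘ σ

/-- The symmetric cone: the set of squares. -/
def symmetricCone (J : EuclideanJordanAlgebra E) : Set E := {x | ∃ y, x = J.mul y y}

end EuclideanJordanAlgebra

/-- The space of symmetric tensors of order two over `V`, as a subspace of `V ⊗ V`
(with the inner product `⟪x ⊗ y, x' ⊗ y'⟫ = ⟪x, x'⟫ ⟪y, y'⟫`). -/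
def SymTensor (V : Type*) [NormedAddCommGroup V] [InnerProductSpace ℝ V] :
    Submodule ℝ (V ⊗[ℝ] V) :=
  LinearMap.eqLocus (TensorProduct.comm ℝ V V).toLinearMap LinearMap.id

/-- The copositive cone over `K`, in the space of symmetric tensors of order two. -/
def copositiveCone {V : Type*} [NormedAddCommGroup V] [InnerProductSpace ℝ V] (K : Set V) :
    Set (SymTensor V) :=
  {A | ∀ x ∈ K, 0 ≤ inner ℝ (A : V ⊗[ℝ] V) (x ⊗ₜ[ℝ] x)}

/-- The matrix of a tensor at a finite family, with entries `⟪A, c i ⊗ c j⟫`. -/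
def tensorMatrix {V : Type*} [NormedAddCommGroup V] [InnerProductSpace ℝ V] {k : ℕ}
    (A : V ⊗[ℝ] V) (c : Fin k → V) : Matrix (Fin k) (Fin k) ℝ :=
  Matrix.of fun i j => inner ℝ A (c i ⊗ₜ[ℝ] c j)

/-- The de Klerk–Pasechnik cone of level `r`: the symmetric `k × k` matrices `A` such that
the polynomial `(x₁ + ⋯ + x_k) ^ r * (xᵀ A x)` has only nonnegative coefficients. -/
def dPCone (k r : ℕ) : Set (Matrix (Fin k) (Fin k) ℝ) :=
  {A | A.IsSymm ∧ ∀ d : Fin k →₀ ℕ,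
    0 ≤ MvPolynomial.coeff d
      ((∑ i, (MvPolynomial.X i : MvPolynomial (Fin k) ℝ)) ^ r *
        ∑ i, ∑ j, MvPolynomial.C (A i j) * MvPolynomial.X i * MvPolynomial.X j)}

/-- The cone of level `r` induced by the de Klerk–Pasechnik cone and a set `F` of frames. -/
def EuclideanJordanAlgebra.innerCone {E : Type*} [NormedAddCommGroup E] [InnerProductSpace ℝ E]
    (J : EuclideanJordanAlgebra E) (F : Set (Fin J.rank → E)) (r : ℕ) : Set (SymTensor E) :=
  ⋂ c ∈ F, {A | tensorMatrix (A : E ⊗[ℝ] E) c ∈ dPCone J.rank r}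

/-- `K` is a closed convex cone; a cone is a nonempty set that is stable under multiplication
by positive reals. -/
def IsClosedConvexCone {V : Type*} [NormedAddCommGroup V] [InnerProductSpace ℝ V]
    (K : Set V) : Prop :=
  K.Nonempty ∧ (∀ a : ℝ, 0 < a → ∀ x ∈ K, a • x ∈ K) ∧ Convex ℝ K ∧ IsClosed K

end

/-! By the spectral theorem (`exists_frame_decomposition`) every `y` is `∑ a i • c i` for an ordered
Jordan frame `c`, so `y ∘ y = ∑ (a i)² • c i`, and a tensor `A` on the square of `y ∘ y` is the
quadratic form of the matrix `A(c)` at a nonnegative vector. Copositivity of `A` thus follows from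
that of the matrices `A(c)`, one ordering per frame being enough. A further factor `∑ x i` preserves
nonnegative coefficients, whence monotonicity in `r`.

For an interior point one level `r` must serve all frames. Interiority gives `ε > 0` with `⟪A, x ⊗
x⟫ ≥ ε ⟪e, x⟫²` on the cone. Norms of nonzero idempotents are bounded above and away from zero, so
`A(c)` has form at least `μ (∑ x i)²` and diagonal at most `B`, with `μ > 0` and `B` independent of
`c`. Explicit Pólya coefficients show that `B ≤ μ (r + 2)` suffices (`mem_dPCone_of_le`).

The spectral theorem comes from power associativity and self-adjointness of multiplication by `x`:
Lagrange interpolation splits `x` into orthogonal idempotents. If `x` has maximal degree there are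
`rank` of them, which forces primitivity. Such `x` are dense and the systems of `rank` idempotents
form a compact set, so the decomposition survives limits. -/

namespace EuclideanJordanAlgebra

/-! ### Power associativity -/

variable {E : Type*} [NormedAddCommGroup E] [InnerProductSpace ℝ E] (J : EuclideanJordanAlgebra E)

/-- The full polarization of the Jordan identity. -/
theorem jordan_polarized (a b c d : E) :
    J.mul a (J.mul (J.mul b c) d) + J.mul b (J.mul (J.mul c a) d) + J.mul c (J.mul (J.mul a b) d) =
      J.mul (J.mul b c) (J.mul a d) + J.mul (J.mul c a) (J.mul b d) +
        J.mul (J.mul a b) (J.mul c d) := by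
  have h₁ := J.jordan (a + b + c) d
  have h₂ := J.jordan (a + b) d
  have h₃ := J.jordan (b + c) d
  have h₄ := J.jordan (a + c) d
  have h₅ := J.jordan a d
  have h₆ := J.jordan b d
  have h₇ := J.jordan c d
  simp only [map_add, LinearMap.add_apply, J.mul_comm b a, J.mul_comm c b, J.mul_comm a c]
    at h₁ h₂ h₃ h₄ h₅ h₆ h₇ ⊢
  linear_combination (norm := module) (2⁻¹ : ℝ) • (h₁ - h₂ - h₃ - h₄ + h₅ + h₆ + h₇)

/-- The multiplication operator of a triple product in terms of multiplication operators. -/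
theorem mul_mul_mul (a b c : E) :
    J.mul (J.mul (J.mul b c) a) = J.mul (J.mul b c) * J.mul a + J.mul (J.mul c a) * J.mul b +
      J.mul (J.mul a b) * J.mul c - J.mul b * J.mul a * J.mul c - J.mul c * J.mul a * J.mul b := by
  ext d
  have h := J.jordan_polarized d b c a
  simp only [LinearMap.add_apply, LinearMap.sub_apply, Module.End.mul_apply]
  rw [J.mul_comm d (J.mul (J.mul b c) a), J.mul_comm d a, J.mul_comm (J.mul c d) a,
    J.mul_comm (J.mul d b) a, J.mul_comm c d, J.mul_comm (J.mul d c) (J.mul b a),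
    J.mul_comm (J.mul d b) (J.mul c a), J.mul_comm b a] at h
  rw [J.mul_comm c d, J.mul_comm b d] at *
  linear_combination (norm := module) h

theorem pow_eq_iterate (x : E) (k : ℕ) : J.pow x k = (J.mul x ^ k) J.one := by
  induction k with
  | zero => rfl
  | succ k ih => rw [pow, ih, pow_succ', Module.End.mul_apply]

theorem mul_one' (x : E) : J.mul x J.one = x := by rw [J.mul_comm, J.one_mul]

theorem commute_mul_sq (x : E) : Commute (J.mul x) (J.mul (J.mul x x)) := by
  ext y
  exact J.jordan x y

/-- With `L` for multiplication, `mul_mul_mul` writes `L(x^(k+2))` as a polynomial in `L(x)`,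
`L(x²)`, `L(x^k)`, `L(x^(k+1))`; hence the two-step induction. -/
theorem commute_mul_pow (x : E) (k : ℕ) :
    Commute (J.mul x) (J.mul (J.pow x k)) ∧ Commute (J.mul (J.mul x x)) (J.mul (J.pow x k)) := by
  have h_one : J.mul J.one = 1 := by ext y; exact J.one_mul y
  induction k using Nat.twoStepInduction with
  | zero => simp [pow, h_one]
  | one => simpa [pow, J.mul_one'] using (J.commute_mul_sq x).symm
  | more k ih₀ ih₁ =>
    have h : J.mul (J.pow x (k + 2)) = J.mul (J.pow x (k + 1)) * J.mul x +
        J.mul (J.pow x (k + 1)) * J.mul x + J.mul (J.mul x x) * J.mul (J.pow x k) -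
        J.mul x * J.mul x * J.mul (J.pow x k) - J.mul (J.pow x k) * J.mul x * J.mul x := by
      have := J.mul_mul_mul x x (J.pow x k)
      rwa [J.mul_comm (J.pow x k) x, J.mul_comm (J.mul x (J.pow x k)) x] at this
    have hs := J.commute_mul_sq x
    rw [h]
    exact ⟨((((ih₁.1.mul_right (.refl _)).add_right (ih₁.1.mul_right (.refl _))).add_right
        (hs.mul_right ih₀.1)).sub_right
        (((Commute.refl _).mul_right (.refl _)).mul_right ih₀.1)).sub_right
        ((ih₀.1.mul_right (.refl _)).mul_right (.refl _)),
      ((((ih₁.2.mul_right hs.symm).add_right (ih₁.2.mul_right hs.symm)).add_right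
        ((Commute.refl _).mul_right ih₀.2)).sub_right
        ((hs.symm.mul_right hs.symm).mul_right ih₀.2)).sub_right
        ((ih₀.2.mul_right hs.symm).mul_right hs.symm)⟩

/-- Power associativity. -/
theorem pow_mul_pow (x : E) (m n : ℕ) : J.mul (J.pow x m) (J.pow x n) = J.pow x (m + n) := by
  have h : Commute (J.mul x ^ n) (J.mul (J.pow x m)) := (J.commute_mul_pow x m).1.pow_left n
  rw [J.pow_eq_iterate x n, ← Module.End.mul_apply, ← h.eq, Module.End.mul_apply, J.mul_one',
    J.pow_eq_iterate x m, J.pow_eq_iterate, ← Module.End.mul_apply, ← pow_add, add_comm]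

/-! ### Polynomial calculus and decomposition into idempotents -/

/-- The value at `x` of a polynomial, with respect to the Jordan product. -/
noncomputable def eval (x : E) : Polynomial ℝ →ₗ[ℝ] E :=
  LinearMap.applyₗ J.one ∘ₗ (Polynomial.aeval (J.mul x)).toLinearMap

theorem eval_apply (x : E) (p : Polynomial ℝ) :
    J.eval x p = (Polynomial.aeval (J.mul x) p) J.one := rfl

theorem eval_X_pow (x : E) (k : ℕ) : J.eval x (Polynomial.X ^ k) = J.pow x k := by
  simp [eval_apply, pow_eq_iterate]

theorem eval_mul (x : E) (p q : Polynomial ℝ) :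
    J.eval x (p * q) = J.mul (J.eval x p) (J.eval x q) := by
  have h : (J.eval x) ∘ₗ (LinearMap.mul ℝ (Polynomial ℝ) p) = J.mul (J.eval x p) ∘ₗ J.eval x := by
    induction p using Polynomial.induction_on' with
    | add p₁ p₂ h₁ h₂ => simp only [map_add, LinearMap.comp_add, LinearMap.add_comp, h₁, h₂]
    | monomial m a =>
      ext n
      simp [← Polynomial.C_mul_X_pow_eq_monomial, ← Polynomial.smul_eq_C_mul, ← pow_add,
        eval_X_pow, pow_mul_pow]
  exact LinearMap.congr_fun h q

theorem mul_isSymmetric (x : E) : (J.mul x).IsSymmetric := fun y z => by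
  rw [J.mul_comm x y, J.inner_mul_left]

/-- The values at `x` of polynomials that agree on a suitable finite set are equal. -/
theorem exists_finset_eval_eq [FiniteDimensional ℝ E] (x : E) :
    ∃ t : Finset ℝ, ∀ p q : Polynomial ℝ, (∀ μ ∈ t, p.eval μ = q.eval μ) →
      J.eval x p = J.eval x q := by
  classical
  have hT := J.mul_isSymmetric x
  -- The finite set is the spectrum of the self-adjoint operator `J.mul x`.
  refine ⟨Finset.univ.image (hT.eigenvalues rfl), fun p q h => ?_⟩
  have : Polynomial.aeval (J.mul x) p = Polynomial.aeval (J.mul x) q := by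
    refine (hT.eigenvectorBasis rfl).toBasis.ext fun i => ?_
    have hi : J.mul x (hT.eigenvectorBasis rfl i) =
        hT.eigenvalues rfl i • hT.eigenvectorBasis rfl i := hT.apply_eigenvectorBasis rfl i
    have hv : Module.End.HasEigenvector (J.mul x) (hT.eigenvalues rfl i)
        (hT.eigenvectorBasis rfl i) := hT.hasEigenvector_eigenvectorBasis rfl i
    simp only [OrthonormalBasis.coe_toBasis]
    rw [Module.End.aeval_apply_of_hasEigenvector hv, Module.End.aeval_apply_of_hasEigenvector hv,
      h _ (Finset.mem_image_of_mem _ (Finset.mem_univ i))]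
  rw [eval_apply, eval_apply, this]

/-- A complete system of pairwise orthogonal nonzero idempotents. -/
def IsCompleteSystem {ι : Type*} [Fintype ι] (c : ι → E) : Prop :=
  (∀ i, J.IsIdempotent (c i) ∧ c i ≠ 0) ∧ (∀ i j, i ≠ j → J.mul (c i) (c j) = 0) ∧
    ∑ i, c i = J.one

/-- The spectral decomposition of an element, and of its powers. -/
theorem exists_spectral_decomposition [FiniteDimensional ℝ E] (x : E) :
    ∃ (s : Finset ℝ) (c : s → E), J.IsCompleteSystem c ∧
      ∀ k, J.pow x k = ∑ μ : s, (μ : ℝ) ^ k • c μ := by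
  classical
  obtain ⟨t, ht⟩ := J.exists_finset_eval_eq x
  have hb : ∀ μ ∈ t, ∀ ν ∈ t, (Lagrange.basis t id μ).eval ν = if μ = ν then 1 else 0 := by
    intro μ hμ ν hν
    split_ifs with h
    · subst h
      exact Lagrange.eval_basis_self (Set.injOn_id _) hμ
    · exact Lagrange.eval_basis_of_ne (v := id) h hν
  -- On `t` the Lagrange polynomials are orthogonal idempotents and `X ^ k` is the sum of `μ ^ k`
  -- times them; both facts transfer to `x`.
  let f : ℝ → E := fun μ => J.eval x (Lagrange.basis t id μ)
  have hf : ∀ μ ∈ t, ∀ ν ∈ t, J.mul (f μ) (f ν) = if μ = ν then f μ else 0 := by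
    intro μ hμ ν hν
    have h0 : (if μ = ν then f μ else 0) =
        J.eval x (if μ = ν then Lagrange.basis t id μ else 0) := by
      rw [apply_ite (J.eval x), map_zero]
    rw [h0, ← eval_mul]
    refine ht _ _ fun ξ hξ => ?_
    rw [Polynomial.eval_mul, hb μ hμ ξ hξ, hb ν hν ξ hξ]
    by_cases h : μ = ν
    · subst h
      simp [hb μ hμ ξ hξ]
    · simp only [h, if_false, Polynomial.eval_zero]
      grind
  have hpow : ∀ k, J.pow x k = ∑ μ ∈ t, μ ^ k • f μ := by
    intro k
    simp only [f, ← map_smul, ← map_sum]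
    rw [← eval_X_pow]
    refine ht _ _ fun ξ hξ => ?_
    rw [Polynomial.eval_finsetSum, Finset.sum_eq_single_of_mem ξ hξ]
    · simp [hb ξ hξ ξ hξ]
    · intro b hbt hne
      simp [hb b hbt ξ hξ, hne]
  -- `J.mul x` can have more eigenvalues than `x` has spectral values, so the vanishing `f μ` are
  -- dropped.
  have hpow' : ∀ k, J.pow x k = ∑ μ : (t.filter (f · ≠ 0) : Finset ℝ), (μ : ℝ) ^ k • f μ := by
    intro k
    rw [hpow k, Finset.sum_coe_sort (t.filter (f · ≠ 0)) (fun μ => μ ^ k • f μ),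
      Finset.sum_filter_of_ne]
    intro μ _ h h0
    exact h (by rw [h0, smul_zero])
  refine ⟨t.filter (f · ≠ 0), fun μ => f μ, ⟨fun i => ?_, fun i j hij => ?_, ?_⟩, hpow'⟩
  · have hi := Finset.mem_filter.1 i.2
    refine ⟨?_, hi.2⟩
    have := hf i hi.1 i hi.1
    rwa [if_pos rfl] at this
  · have := hf i (Finset.mem_filter.1 i.2).1 j (Finset.mem_filter.1 j.2).1
    rwa [if_neg (fun h => hij (Subtype.ext h))] at this
  · have := hpow' 0
    simp only [pow_zero, one_smul] at this
    exact this.symm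

/-! ### Positivity and norm bounds for idempotents -/

variable {J} in
-- The operator `T = J.mul d` is self-adjoint with `2T³ - 3T² + T = 0`, so `T = T² + 4(T - T²)²`,
-- which is positive semidefinite.
theorem IsIdempotent.inner_mul_self {d : E} (hd : J.IsIdempotent d) (x : E) :
    inner ℝ (J.mul d x) x = ‖J.mul d x‖ ^ 2 +
      4 * ‖J.mul d x - J.mul d (J.mul d x)‖ ^ 2 := by
  have hcubic : ∀ y, J.mul d y = (3 : ℝ) • J.mul d (J.mul d y) -
      (2 : ℝ) • J.mul d (J.mul d (J.mul d y)) := by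
    intro y
    have h := LinearMap.congr_fun (J.mul_mul_mul d d d) y
    have hd' : J.mul d d = d := hd
    simp only [hd', LinearMap.sub_apply, LinearMap.add_apply, Module.End.mul_apply] at h
    linear_combination (norm := module) h
  have hs : ∀ y z, inner ℝ (J.mul d y) z = inner ℝ y (J.mul d z) := J.mul_isSymmetric d
  have h₁ := hcubic x
  have h₂ := congrArg (J.mul d) h₁
  rw [map_sub, map_smul, map_smul] at h₂
  simp only [← real_inner_self_eq_norm_sq, inner_sub_left, inner_sub_right]
  have e₁ := congrArg (fun v => inner ℝ v x) h₁
  have e₂ := congrArg (fun v => inner ℝ v x) h₂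
  simp only [inner_sub_left, inner_smul_left, hs, conj_trivial] at e₁ e₂ ⊢
  linarith

variable {J} in
/-- An element orthogonal to its product with an idempotent is annihilated by the idempotent. -/
theorem IsIdempotent.mul_eq_zero_of_inner {d x : E} (hd : J.IsIdempotent d)
    (h : inner ℝ (J.mul d x) x = 0) : J.mul d x = 0 := by
  rw [hd.inner_mul_self] at h
  have : ‖J.mul d x‖ ^ 2 = 0 := by
    have h₁ := sq_nonneg ‖J.mul d x‖
    have h₂ := sq_nonneg ‖J.mul d x - J.mul d (J.mul d x)‖
    linarith
  simpa using this

variable {J} in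
theorem IsIdempotent.norm_le {c : E} (hc : J.IsIdempotent c) : ‖c‖ ≤ ‖J.one‖ := by
  have hc' : J.mul c c = c := hc
  have h : ‖c‖ ^ 2 ≤ ‖c‖ * ‖J.one‖ := by
    calc ‖c‖ ^ 2 = inner ℝ (J.mul c c) J.one := by
          rw [J.inner_mul_left, J.mul_one', real_inner_self_eq_norm_sq]
      _ ≤ ‖c‖ * ‖J.one‖ := by
          rw [hc']
          exact real_inner_le_norm _ _
  rcases (norm_nonneg c).eq_or_lt' with h0 | h0
  · rw [h0]
    exact norm_nonneg _
  · exact le_of_mul_le_mul_left (by rwa [sq] at h) h0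

theorem inner_one_idempotent {c : E} (hc : J.IsIdempotent c) :
    inner ℝ J.one c = ‖c‖ ^ 2 := by
  have hc' : J.mul c c = c := hc
  rw [← real_inner_self_eq_norm_sq]
  conv_lhs => rw [← hc', ← J.inner_mul_left, J.one_mul]

/-- The Jordan product as a continuous bilinear map. -/
noncomputable def mulL [FiniteDimensional ℝ E] : E →L[ℝ] E →L[ℝ] E :=
  LinearMap.toContinuousLinearMap (LinearMap.toContinuousLinearMap.toLinearMap ∘ₗ J.mul)

theorem continuous_mul [FiniteDimensional ℝ E] : Continuous fun p : E × E => J.mul p.1 p.2 :=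
  J.mulL.continuous₂

/-- From `c = c ∘ c`, `‖c‖ ≤ M ‖c‖²` with `M` the norm of the product. The `+ 1` only makes the
inverted constant positive. -/
theorem exists_le_norm_sq_of_isIdempotent [FiniteDimensional ℝ E] :
    ∃ δ : ℝ, 0 < δ ∧ ∀ c, J.IsIdempotent c → c ≠ 0 → δ ≤ ‖c‖ ^ 2 := by
  refine ⟨((‖J.mulL‖ + 1)⁻¹) ^ 2, by positivity, fun c hc h0 => ?_⟩
  have hc' : J.mulL c c = c := hc
  have h₁ : ‖c‖ ≤ ‖J.mulL‖ * ‖c‖ * ‖c‖ := by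
    conv_lhs => rw [← hc']
    exact J.mulL.le_opNorm₂ c c
  have h₂ : 0 < ‖c‖ := norm_pos_iff.2 h0
  have h₃ : 1 ≤ (‖J.mulL‖ + 1) * ‖c‖ := by
    have : 1 * ‖c‖ ≤ (‖J.mulL‖ * ‖c‖) * ‖c‖ := by rwa [_root_.one_mul]
    have := le_of_mul_le_mul_right this h₂
    linarith
  gcongr
  rw [inv_le_iff_one_le_mul₀ (by positivity)]
  linarith

variable {J} in
theorem inner_eq_zero_of_mul_eq_zero {c d : E} (hc : J.IsIdempotent c) (h : J.mul c d = 0) :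
    inner ℝ c d = 0 := by
  have hc' : J.mul c c = c := hc
  rw [← hc', J.inner_mul_left, h, inner_zero_right]

/-! ### Degree, rank and complete systems -/

theorem degree_set_nonempty [FiniteDimensional ℝ E] (x : E) :
    Module.finrank ℝ E ∈ {k : ℕ | ¬ LinearIndependent ℝ (fun i : Fin (k + 1) => J.pow x i)} := by
  intro h
  have := h.fintype_card_le_finrank
  simp at this

theorem le_degree [FiniteDimensional ℝ E] {x : E} {k : ℕ}
    (h : LinearIndependent ℝ (fun i : Fin k => J.pow x i)) : k ≤ J.degree x := by
  refine le_csInf ⟨_, J.degree_set_nonempty x⟩ fun m hm => ?_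
  by_contra! hlt
  exact hm (h.comp (Fin.castLE hlt) (Fin.castLE_injective hlt))

theorem linearIndependent_pow_degree (x : E) :
    LinearIndependent ℝ (fun i : Fin (J.degree x) => J.pow x i) := by
  rcases h : J.degree x with _ | n
  · exact linearIndependent_empty_type
  · have := Nat.notMem_of_lt_sInf (h ▸ Nat.lt_succ_self n : n < J.degree x)
    simpa using this

theorem bddAbove_degree [FiniteDimensional ℝ E] : BddAbove (Set.range J.degree) :=
  ⟨Module.finrank ℝ E, Set.forall_mem_range.2 fun x => Nat.sInf_le (J.degree_set_nonempty x)⟩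

theorem exists_degree_eq_rank [FiniteDimensional ℝ E] : ∃ x, J.degree x = J.rank :=
  Nat.sSup_mem (Set.range_nonempty J.degree) J.bddAbove_degree

section CompleteSystem

variable {J} {ι : Type*} [Fintype ι] {c : ι → E}

theorem IsCompleteSystem.inner_eq_zero (hc : J.IsCompleteSystem c) {i j : ι} (h : i ≠ j) :
    inner ℝ (c i) (c j) = 0 :=
  inner_eq_zero_of_mul_eq_zero (hc.1 i).1 (hc.2.1 i j h)

theorem IsCompleteSystem.linearIndependent (hc : J.IsCompleteSystem c) : LinearIndependent ℝ c :=
  linearIndependent_of_ne_zero_of_inner_eq_zero (fun i => (hc.1 i).2)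
    (fun _ _ => hc.inner_eq_zero)

theorem IsCompleteSystem.comp_equiv {κ : Type*} [Fintype κ] (hc : J.IsCompleteSystem c)
    (e : κ ≃ ι) : J.IsCompleteSystem (c ∘ e) :=
  ⟨fun i => hc.1 (e i), fun _ _ h => hc.2.1 _ _ (e.injective.ne h),
    (e.sum_comp c).trans hc.2.2⟩

theorem IsCompleteSystem.mul_sum_smul (hc : J.IsCompleteSystem c) (a b : ι → ℝ) :
    J.mul (∑ i, a i • c i) (∑ i, b i • c i) = ∑ i, (a i * b i) • c i := by
  simp only [map_sum, LinearMap.sum_apply, map_smul, LinearMap.smul_apply]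
  refine Finset.sum_congr rfl fun i _ => ?_
  rw [Finset.sum_eq_single_of_mem i (Finset.mem_univ i)]
  · have : J.mul (c i) (c i) = c i := (hc.1 i).1
    rw [this, smul_smul, _root_.mul_comm]
  · intro j _ hj
    rw [hc.2.1 _ _ hj, smul_zero]

theorem IsCompleteSystem.pow_sum_smul (hc : J.IsCompleteSystem c) (a : ι → ℝ)
    (k : ℕ) : J.pow (∑ i, a i • c i) k = ∑ i, a i ^ k • c i := by
  induction k with
  | zero => simp [pow, hc.2.2]
  | succ k ih =>
    rw [pow, ih, hc.mul_sum_smul]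
    simp only [pow_succ']

/-- Distinct coefficients `0, 1, 2, …` on the idempotents give an element whose first powers are
independent, by Vandermonde. -/
theorem IsCompleteSystem.card_le_rank [FiniteDimensional ℝ E] (hc : J.IsCompleteSystem c) :
    Fintype.card ι ≤ J.rank := by
  have hd := hc.comp_equiv (Fintype.equivFin ι).symm
  set d := c ∘ (Fintype.equivFin ι).symm
  refine (J.le_degree (x := ∑ i : Fin (Fintype.card ι), ((i : ℕ) : ℝ) • d i) ?_).trans
    (le_ciSup J.bddAbove_degree _)
  rw [Fintype.linearIndependent_iff]
  intro g hg
  refine congrFun (Matrix.eq_zero_of_forall_index_sum_pow_mul_eq_zero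
    (f := fun i : Fin (Fintype.card ι) => ((i : ℕ) : ℝ)) (v := g)
    (fun i j h => Fin.ext (Nat.cast_injective h)) ?_)
  refine Fintype.linearIndependent_iff.1 hd.linearIndependent _ ?_
  simp only [hd.pow_sum_smul, Finset.smul_sum, smul_smul] at hg
  rw [Finset.sum_comm] at hg
  rw [← hg]
  refine Finset.sum_congr rfl fun i _ => ?_
  rw [Finset.sum_smul]
  simp only [_root_.mul_comm]

/-- In a complete system of maximal cardinality the idempotents are primitive. -/
theorem IsCompleteSystem.isPrimitive [FiniteDimensional ℝ E] (hc : J.IsCompleteSystem c)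
    (h : J.rank ≤ Fintype.card ι) (i : ι) : J.IsPrimitive (c i) := by
  classical
  refine ⟨(hc.1 i).1, (hc.1 i).2, ?_⟩
  rintro ⟨a, b, ha, hb, ha0, hb0, hab⟩
  have ha' : J.mul a a = a := ha
  have hb' : J.mul b b = b := hb
  have hi : J.mul (c i) (c i) = c i := (hc.1 i).1
  have hab0 : J.mul a b = 0 := by
    rw [hab] at hi
    simp only [map_add, LinearMap.add_apply, ha', hb', J.mul_comm b a] at hi
    have : (2 : ℝ) • J.mul a b = 0 := by linear_combination (norm := module) hi
    simpa using this
  -- `⟪c j ∘ u, u⟫ = ⟪c j, u⟫ = ⟪c j, u ∘ c i⟫ = 0`, and positivity of multiplication by `c j` turns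
  -- this into `c j ∘ u = 0`.
  have key : ∀ u : E, J.IsIdempotent u → J.mul u (c i) = u → ∀ j ≠ i, J.mul u (c j) = 0 := by
    intro u hu hui j hj
    rw [J.mul_comm]
    refine (hc.1 j).1.mul_eq_zero_of_inner ?_
    have hu' : J.mul u u = u := hu
    rw [J.mul_comm, real_inner_comm, ← J.inner_mul_left, hu', ← hui, J.inner_mul_left,
      hc.2.1 i j hj.symm, inner_zero_right]
  have hac : ∀ j ≠ i, J.mul a (c j) = 0 := key a ha (by rw [hab, map_add, ha', hab0, add_zero])
  have hbc : ∀ j ≠ i, J.mul b (c j) = 0 :=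
    key b hb (by rw [hab, map_add, hb', J.mul_comm, hab0, zero_add])
  -- Splitting `c i` into `a` and `b` yields a complete system with one more member than the rank
  -- allows.
  have hsys : J.IsCompleteSystem (fun o : Option ι => o.elim b (Function.update c i a)) := by
    refine ⟨?_, ?_, ?_⟩
    · rintro (_ | j)
      · exact ⟨hb, hb0⟩
      · by_cases hj : j = i
        · subst hj
          simpa using ⟨ha, ha0⟩
        · simpa [hj] using hc.1 j
    · rintro (_ | j) (_ | l) hjl
      · exact absurd rfl hjl
      · by_cases hl : l = i
        · subst hl
          simpa [J.mul_comm b a] using hab0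
        · simpa [hl] using hbc l hl
      · by_cases hj : j = i
        · subst hj
          simpa using hab0
        · simpa [hj, J.mul_comm _ b] using hbc j hj
      · have hjl' : j ≠ l := fun h => hjl (congrArg some h)
        by_cases hj : j = i
        · subst hj
          simpa [hjl'.symm] using hac l hjl'.symm
        · by_cases hl : l = i
          · subst hl
            simpa [hj, J.mul_comm _ a] using hac j hj
          · simpa [hj, hl] using hc.2.1 j l hjl'
    · rw [Fintype.sum_option]
      simp only [Option.elim_none, Option.elim_some]
      rw [Finset.sum_update_of_mem (Finset.mem_univ i), ← hc.2.2,
        ← Finset.add_sum_erase _ _ (Finset.mem_univ i), hab, Finset.sdiff_singleton_eq_erase]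
      abel
  have := hsys.card_le_rank
  rw [Fintype.card_option] at this
  omega

end CompleteSystem

variable {J} in
theorem IsJordanFrame.isCompleteSystem {k : ℕ} {c : Fin k → E} (hc : J.IsJordanFrame c) :
    J.IsCompleteSystem c :=
  ⟨fun i => ⟨(hc.1 i).1, (hc.1 i).2.1⟩, hc.2⟩

variable {J} in
theorem IsCompleteSystem.mem_orderedFrames [FiniteDimensional ℝ E] {c : Fin J.rank → E}
    (hc : J.IsCompleteSystem c) : c ∈ J.orderedFrames :=
  ⟨hc.isPrimitive (by simp), hc.2⟩

/-! ### The spectral theorem, by density and compactness -/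

/-- An element of maximal degree is a combination of the members of an ordered Jordan frame. -/
theorem exists_frame_of_linearIndependent [FiniteDimensional ℝ E] {x : E}
    (h : LinearIndependent ℝ (fun i : Fin J.rank => J.pow x i)) :
    ∃ c ∈ J.orderedFrames, ∃ a : Fin J.rank → ℝ, x = ∑ i, a i • c i := by
  classical
  obtain ⟨s, c, hc, hpow⟩ := J.exists_spectral_decomposition x
  have hle : J.rank ≤ Fintype.card s := by
    have hspan : Set.range (fun i : Fin J.rank => J.pow x i) ≤ Submodule.span ℝ (Set.range c) := by
      rintro _ ⟨i, rfl⟩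
      simp only [hpow]
      exact Submodule.sum_mem _ fun μ _ =>
        Submodule.smul_mem _ _ (Submodule.subset_span (Set.mem_range_self μ))
    have := linearIndependent_le_span_aux' _ h (Set.range c) hspan
    rw [Fintype.card_fin] at this
    exact this.trans (Fintype.card_range_le c)
  have hcard : Fintype.card s = J.rank := le_antisymm hc.card_le_rank hle
  have e : Fin J.rank ≃ s := (Fintype.equivFinOfCardEq hcard).symm
  refine ⟨c ∘ e, (hc.comp_equiv e).mem_orderedFrames, fun i => e i, ?_⟩
  have hx : x = ∑ μ : s, (μ : ℝ) • c μ := by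
    have := hpow 1
    simpa [pow, J.mul_one'] using this
  rw [hx]
  exact (e.sum_comp fun μ : s => (μ : ℝ) • c μ).symm

theorem analyticAt_pow_line [FiniteDimensional ℝ E] (y z : E) (k : ℕ) (t : ℝ) :
    AnalyticAt ℝ (fun t : ℝ => J.pow (y + t • z) k) t := by
  have hline : AnalyticAt ℝ (fun t : ℝ => y + t • z) t := by fun_prop
  induction k with
  | zero => exact analyticAt_const
  | succ k ih => exact J.mulL.analyticAt_bilinear _ |>.comp₂ hline ih

/-- The elements of maximal degree are dense. -/
theorem dense_linearIndependent_pow [FiniteDimensional ℝ E] :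
    Dense {x : E | LinearIndependent ℝ (fun i : Fin J.rank => J.pow x i)} := by
  intro y
  obtain ⟨x, hx⟩ := J.exists_degree_eq_rank
  have hx' : LinearIndependent ℝ (fun i : Fin J.rank => J.pow x i) :=
    hx ▸ J.linearIndependent_pow_degree x
  -- The Gram determinant along the line from `y` to a maximal-degree `x` is analytic and nonzero at
  -- `t = 1`, so it cannot vanish identically near `0`.
  let f : ℝ → ℝ := fun t =>
    (Matrix.gram ℝ fun i : Fin J.rank => J.pow (y + t • (x - y)) i).det
  have hf : AnalyticOnNhd ℝ f Set.univ := by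
    intro t _
    simp only [f, Matrix.det_apply, Matrix.gram_apply]
    refine Finset.analyticAt_fun_sum _ fun σ _ => ?_
    refine AnalyticAt.const_smul (Finset.analyticAt_fun_prod _ fun i _ => ?_)
    exact ((innerSL ℝ).analyticAt_bilinear _).comp₂ (J.analyticAt_pow_line y (x - y) _ t)
      (J.analyticAt_pow_line y (x - y) _ t)
  have hfreq : ∃ᶠ t in nhds (0 : ℝ), f t ≠ 0 := by
    intro h
    have h' := hf.eqOn_zero_of_preconnected_of_eventuallyEq_zero isPreconnected_univ
      (Set.mem_univ 0) (h.mono fun t ht => not_not.1 ht)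
    have h₁ : f 1 = 0 := h' (Set.mem_univ 1)
    refine Matrix.det_gram_ne_zero_iff_linearIndependent.2 hx' ?_
    simpa [f] using h₁
  have htend : Filter.Tendsto (fun t : ℝ => y + t • (x - y)) (nhds 0) (nhds y) := by
    have : Continuous fun t : ℝ => y + t • (x - y) := by fun_prop
    simpa using this.tendsto 0
  exact mem_closure_of_frequently_of_tendsto
    (hfreq.mono fun t ht => Matrix.det_gram_ne_zero_iff_linearIndependent.1 ht) htend

/-- The open condition `c i ≠ 0` may be replaced by the closed one `δ ≤ ‖c i‖ ^ 2`; primitivity is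
not imposed, since it is automatic for `rank` members. -/
theorem isCompact_setOf_isCompleteSystem [FiniteDimensional ℝ E] {ι : Type*} [Fintype ι] :
    IsCompact {c : ι → E | J.IsCompleteSystem c} := by
  obtain ⟨δ, hδ, hle⟩ := J.exists_le_norm_sq_of_isIdempotent
  have hset : {c : ι → E | J.IsCompleteSystem c} =
      (⋂ i, {c : ι → E | J.mul (c i) (c i) = c i}) ∩ (⋂ i, {c : ι → E | δ ≤ ‖c i‖ ^ 2}) ∩
      (⋂ i, ⋂ j, ⋂ (_ : i ≠ j), {c : ι → E | J.mul (c i) (c j) = 0}) ∩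
      {c : ι → E | ∑ i, c i = J.one} := by
    ext c
    simp only [IsCompleteSystem, Set.mem_inter_iff, Set.mem_iInter, Set.mem_ofPred_eq]
    refine ⟨fun h => ⟨⟨⟨fun i => (h.1 i).1, fun i => hle _ (h.1 i).1 (h.1 i).2⟩, h.2.1⟩, h.2.2⟩,
      fun h => ⟨fun i => ⟨h.1.1.1 i, fun h0 => ?_⟩, h.1.2, h.2⟩⟩
    have := h.1.1.2 i
    rw [h0, norm_zero] at this
    linarith [zero_pow (M₀ := ℝ) two_ne_zero]
  have hmul : ∀ i j, Continuous fun c : ι → E => J.mul (c i) (c j) := fun i j =>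
    J.continuous_mul.comp (f := fun c : ι → E => (c i, c j)) (by fun_prop)
  refine Metric.isCompact_of_isClosed_isBounded ?_ ?_
  · rw [hset]
    refine ((IsClosed.inter ?_ ?_).inter ?_).inter ?_
    · exact isClosed_iInter fun i => isClosed_eq (hmul i i) (continuous_apply i)
    · exact isClosed_iInter fun i => isClosed_le continuous_const (by fun_prop)
    · exact isClosed_iInter fun i => isClosed_iInter fun j => isClosed_iInter fun _ =>
        isClosed_eq (hmul i j) continuous_const
    · exact isClosed_eq (by fun_prop) continuous_const
  · refine (Metric.isBounded_closedBall (x := (0 : ι → E)) (r := ‖J.one‖)).subset fun c hc => ?_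
    rw [mem_closedBall_zero_iff, pi_norm_le_iff_of_nonneg (norm_nonneg _)]
    exact fun i => (hc.1 i).1.norm_le

/-- The spectral theorem: every element is a combination of the members of an ordered
Jordan frame. -/
theorem exists_frame_decomposition [FiniteDimensional ℝ E] (x : E) :
    ∃ c ∈ J.orderedFrames, ∃ a : Fin J.rank → ℝ, x = ∑ i, a i • c i := by
  let K : Set (Fin J.rank → E) := {c | J.IsCompleteSystem c}
  have : CompactSpace K := isCompact_iff_compactSpace.1 J.isCompact_setOf_isCompleteSystem
  -- By orthogonality the coefficients are continuous functions of the pair, so `S` is closed, and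
  -- its projection along the compact `K` is a closed set containing a dense one.
  let S : Set (K × E) :=
    {p | p.2 = ∑ i, (inner ℝ p.2 (p.1.1 i) / ‖p.1.1 i‖ ^ 2) • p.1.1 i}
  have hS : IsClosed S := by
    have hc : ∀ i, Continuous fun p : K × E => p.1.1 i := fun i =>
      (continuous_apply i).comp (continuous_subtype_val.comp continuous_fst)
    refine isClosed_eq continuous_snd (continuous_finsetSum _ fun i _ => ?_)
    refine Continuous.smul (Continuous.div (continuous_snd.inner (hc i)) ((hc i).norm.pow 2)
      fun p => ?_) (hc i)
    exact pow_ne_zero 2 (norm_ne_zero_iff.2 (p.1.2.1 i).2)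
  have hT : IsClosed (Prod.snd '' S) := isClosedMap_snd_of_compactSpace S hS
  have hsub : {x : E | LinearIndependent ℝ (fun i : Fin J.rank => J.pow x i)} ⊆ Prod.snd '' S := by
    intro z hz
    obtain ⟨c, hc, a, ha⟩ := J.exists_frame_of_linearIndependent hz
    have hcs : J.IsCompleteSystem c := IsJordanFrame.isCompleteSystem hc
    refine ⟨(⟨c, hcs⟩, z), ?_, rfl⟩
    change z = ∑ i, (inner ℝ z (c i) / ‖c i‖ ^ 2) • c i
    have : ∀ i, inner ℝ z (c i) / ‖c i‖ ^ 2 = a i := by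
      intro i
      rw [div_eq_iff (pow_ne_zero 2 (norm_ne_zero_iff.2 (hcs.1 i).2)), ha, sum_inner,
        Finset.sum_eq_single_of_mem i (Finset.mem_univ i)]
      · rw [real_inner_smul_left, real_inner_self_eq_norm_sq]
      · intro j _ hj
        rw [real_inner_smul_left, hcs.inner_eq_zero hj, mul_zero]
    simp only [this]
    exact ha
  obtain ⟨⟨c, z⟩, hz, rfl⟩ := hT.closure_subset_iff.2 hsub (J.dense_linearIndependent_pow x)
  exact ⟨c.1, c.2.mem_orderedFrames, _, hz⟩

end EuclideanJordanAlgebra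

/-! ### Pólya coefficients and the de Klerk–Pasechnik cones -/

section Polya

open MvPolynomial

variable {k : ℕ}

/-- The coefficient at `d`, multiplied by the factorials of the exponents. -/
noncomputable def factorialCoeff (d : Fin k →₀ ℕ) (p : MvPolynomial (Fin k) ℝ) : ℝ :=
  (∏ i, ((d i).factorial : ℝ)) * coeff d p

/-- In this normalisation multiplication by a variable is a weighted shift. Truncated subtraction is
harmless: the weight `d i` vanishes there. -/
theorem factorialCoeff_X_mul (d : Fin k →₀ ℕ) (i : Fin k) (p : MvPolynomial (Fin k) ℝ) :
    factorialCoeff d (X i * p) = d i * factorialCoeff (d - Finsupp.single i 1) p := by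
  classical
  rw [factorialCoeff, coeff_X_mul']
  by_cases h : d i = 0
  · simp [h]
  · rw [if_pos (Finsupp.mem_support_iff.2 h), factorialCoeff, ← mul_assoc]
    congr 1
    rw [← Finset.mul_prod_erase _ _ (Finset.mem_univ i),
      ← Finset.mul_prod_erase (a := i) _ _ (Finset.mem_univ i), ← mul_assoc]
    congr 1
    · have : (d - Finsupp.single i 1 : Fin k →₀ ℕ) i = d i - 1 := by simp
      rw [this, ← Nat.cast_mul, Nat.mul_factorial_pred h]
    · refine Finset.prod_congr rfl fun j hj => ?_
      have : (d - Finsupp.single i 1 : Fin k →₀ ℕ) j = d j := by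
        simp [Finsupp.single_eq_of_ne (Finset.ne_of_mem_erase hj)]
      rw [this]

theorem degree_sub_single {d : Fin k →₀ ℕ} {i : Fin k} (h : d i ≠ 0) :
    (d - Finsupp.single i 1).degree + 1 = d.degree := by
  have h' : d - Finsupp.single i 1 + Finsupp.single i 1 = d :=
    tsub_add_cancel_of_le (Finsupp.single_le_iff.2 (Nat.one_le_iff_ne_zero.2 h))
  conv_rhs => rw [← h', map_add, Finsupp.degree_single]

/-- The multinomial theorem in this normalisation. -/
theorem factorialCoeff_sum_X_pow (r : ℕ) (d : Fin k →₀ ℕ) (hd : d.degree = r) :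
    factorialCoeff d ((∑ i, X i) ^ r) = r.factorial := by
  classical
  induction r generalizing d with
  | zero =>
    obtain rfl : d = 0 := (Finsupp.degree_eq_zero_iff d).1 hd
    simp [factorialCoeff]
  | succ r ih =>
    have hadd : factorialCoeff d ((∑ i, X i) ^ (r + 1)) =
        ∑ i, factorialCoeff d (X i * (∑ i, X i) ^ r) := by
      simp only [factorialCoeff, pow_succ', Finset.sum_mul, coeff_sum, Finset.mul_sum]
    have : ∀ i, factorialCoeff d (X i * (∑ i, X i) ^ r) = d i * r.factorial := by
      intro i
      rw [factorialCoeff_X_mul]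
      by_cases h : d i = 0
      · simp [h]
      · rw [ih _ (by have := degree_sub_single h; omega)]
    rw [hadd, Finset.sum_congr rfl fun i _ => this i, ← Finset.sum_mul, ← Nat.cast_sum,
      ← Finsupp.degree_eq_sum, hd, Nat.factorial_succ, Nat.cast_mul]

/-- The polynomial of the de Klerk–Pasechnik cones. -/
noncomputable def dPPolynomial (r : ℕ) (A : Matrix (Fin k) (Fin k) ℝ) : MvPolynomial (Fin k) ℝ :=
  (∑ i, X i) ^ r * ∑ i, ∑ j, C (A i j) * X i * X j

/-- Two shifts contribute the weight `d i * (d j - δ_ij)`; the Kronecker term is the source of the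
diagonal correction. -/
theorem factorialCoeff_dPPolynomial (r : ℕ) (A : Matrix (Fin k) (Fin k) ℝ) (d : Fin k →₀ ℕ)
    (hd : d.degree = r + 2) :
    factorialCoeff d (dPPolynomial r A) =
      r.factorial * ((∑ i, ∑ j, A i j * (d i * d j)) - ∑ i, A i i * d i) := by
  classical
  have h₁ : factorialCoeff d (dPPolynomial r A) =
      ∑ i, ∑ j, A i j * factorialCoeff d (X i * (X j * (∑ i, X i) ^ r)) := by
    have : dPPolynomial r A = ∑ i, ∑ j, C (A i j) * (X i * (X j * (∑ i, X i) ^ r)) := by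
      rw [dPPolynomial, Finset.mul_sum]
      refine Finset.sum_congr rfl fun i _ => ?_
      rw [Finset.mul_sum]
      refine Finset.sum_congr rfl fun j _ => ?_
      ring
    simp only [this, factorialCoeff, coeff_sum, coeff_C_mul, Finset.mul_sum]
    refine Finset.sum_congr rfl fun i _ => Finset.sum_congr rfl fun j _ => ?_
    ring
  have h₂ : ∀ i j, factorialCoeff d (X i * (X j * (∑ i, X i) ^ r)) =
      r.factorial * (d i * d j - if i = j then (d i : ℝ) else 0) := by
    intro i j
    rw [factorialCoeff_X_mul]
    by_cases hi : d i = 0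
    · simp [hi]
    rw [factorialCoeff_X_mul]
    have hi' := degree_sub_single hi
    have hc : (((d - Finsupp.single i 1 : Fin k →₀ ℕ) j : ℕ) : ℝ) = d j - if i = j then 1 else 0 := by
      split_ifs with h
      · subst h
        simp [Nat.cast_sub (Nat.one_le_iff_ne_zero.2 hi)]
      · simp [Finsupp.single_eq_of_ne (Ne.symm h)]
    by_cases hj : (d - Finsupp.single i 1 : Fin k →₀ ℕ) j = 0
    · have : (d j : ℝ) - (if i = j then 1 else 0) = 0 := by rw [← hc, hj, Nat.cast_zero]
      rw [hj]
      split_ifs at this ⊢ with h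
      · linear_combination (-(r.factorial * d i : ℝ)) * this
      · linear_combination (-(r.factorial * d i : ℝ)) * this
    · rw [factorialCoeff_sum_X_pow r _ (by have := degree_sub_single hj; omega), hc]
      split_ifs <;> ring
  rw [h₁]
  simp only [h₂, mul_sub, Finset.sum_sub_distrib, Finset.mul_sum]
  congr 1
  · refine Finset.sum_congr rfl fun i _ => Finset.sum_congr rfl fun j _ => ?_
    ring
  · refine Finset.sum_congr rfl fun i _ => ?_
    rw [Finset.sum_eq_single_of_mem i (Finset.mem_univ i)]
    · rw [if_pos rfl]
      ring
    · intro j _ hj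
      rw [if_neg hj.symm]
      ring

theorem dPPolynomial_isHomogeneous (r : ℕ) (A : Matrix (Fin k) (Fin k) ℝ) :
    (dPPolynomial r A).IsHomogeneous (r + 2) := by
  have h₁ : ((∑ i, X i : MvPolynomial (Fin k) ℝ) ^ r).IsHomogeneous (1 * r) :=
    (IsHomogeneous.sum _ _ _ fun i _ => isHomogeneous_X ℝ i).pow r
  rw [one_mul] at h₁
  exact h₁.mul (IsHomogeneous.sum _ _ _ fun i _ => IsHomogeneous.sum _ _ _ fun j _ =>
    ((isHomogeneous_C _ _).mul (isHomogeneous_X ℝ i)).mul (isHomogeneous_X ℝ j))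

/-- A quantitative form of Pólya's theorem for quadratic forms. -/
theorem mem_dPCone_of_le {A : Matrix (Fin k) (Fin k) ℝ} (hA : A.IsSymm) {μ B : ℝ}
    (hquad : ∀ x : Fin k → ℝ, (∀ i, 0 ≤ x i) → μ * (∑ i, x i) ^ 2 ≤ ∑ i, ∑ j, A i j * (x i * x j))
    (hdiag : ∀ i, A i i ≤ B) {r : ℕ} (hr : B ≤ μ * (r + 2)) : A ∈ dPCone k r := by
  refine ⟨hA, fun d => ?_⟩
  change 0 ≤ coeff d (dPPolynomial r A)
  by_cases hd : d.degree = r + 2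
  · have hsum : ∑ i, (d i : ℝ) = r + 2 := by
      rw [← Nat.cast_sum, ← Finsupp.degree_eq_sum, hd]
      push_cast
      rfl
    have h₁ := hquad (fun i => d i) fun i => Nat.cast_nonneg _
    have h₂ : ∑ i, A i i * d i ≤ B * (r + 2) := by
      rw [← hsum, Finset.mul_sum]
      exact Finset.sum_le_sum fun i _ => mul_le_mul_of_nonneg_right (hdiag i) (Nat.cast_nonneg _)
    have h₃ : B * (r + 2) ≤ μ * (r + 2) * (r + 2) := mul_le_mul_of_nonneg_right hr (by positivity)
    rw [hsum] at h₁
    -- The form at `d` is at least `μ (r + 2)²` and the diagonal correction at most `B (r + 2)`.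
    have h₄ : 0 ≤ factorialCoeff d (dPPolynomial r A) := by
      rw [factorialCoeff_dPPolynomial r A d hd]
      refine mul_nonneg (Nat.cast_nonneg _) ?_
      linarith
    exact nonneg_of_mul_nonneg_right h₄ (Finset.prod_pos fun i _ => by positivity)
  · exact (((dPPolynomial_isHomogeneous r A).coeff_eq_zero hd).symm).le

theorem dPCone_subset_succ (k r : ℕ) : dPCone k r ⊆ dPCone k (r + 1) := by
  classical
  rintro A ⟨hA, h⟩
  refine ⟨hA, fun d => ?_⟩
  rw [pow_succ', mul_assoc, Finset.sum_mul, coeff_sum]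
  refine Finset.sum_nonneg fun i _ => ?_
  rw [coeff_X_mul']
  split_ifs
  exacts [h _, le_rfl]

/-- The matrices of the de Klerk–Pasechnik cones are copositive. -/
theorem quadratic_nonneg_of_mem_dPCone {r : ℕ} {A : Matrix (Fin k) (Fin k) ℝ} (hA : A ∈ dPCone k r)
    {x : Fin k → ℝ} (hx : ∀ i, 0 ≤ x i) : 0 ≤ ∑ i, ∑ j, A i j * (x i * x j) := by
  have h : 0 ≤ eval x (dPPolynomial r A) := by
    rw [eval_eq]
    exact Finset.sum_nonneg fun d _ =>
      mul_nonneg (hA.2 d) (Finset.prod_nonneg fun i _ => pow_nonneg (hx i) _)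
  have h' : eval x (dPPolynomial r A) = (∑ i, x i) ^ r * ∑ i, ∑ j, A i j * (x i * x j) := by
    simp [dPPolynomial, mul_assoc]
  rw [h'] at h
  rcases (Finset.sum_nonneg fun i (_ : i ∈ Finset.univ) => hx i).eq_or_lt' with h0 | h0
  · have := (Finset.sum_eq_zero_iff_of_nonneg fun i (_ : i ∈ Finset.univ) => hx i).1 h0
    simp [this]
  · exact nonneg_of_mul_nonneg_right h (pow_pos h0 r)

theorem zero_mem_dPCone (k r : ℕ) : (0 : Matrix (Fin k) (Fin k) ℝ) ∈ dPCone k r :=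
  ⟨Matrix.isSymm_zero, fun d => by simp⟩

theorem coeff_dPPolynomial_add (r : ℕ) (A B : Matrix (Fin k) (Fin k) ℝ) (d : Fin k →₀ ℕ) :
    coeff d (dPPolynomial r (A + B)) = coeff d (dPPolynomial r A) + coeff d (dPPolynomial r B) := by
  rw [← coeff_add]
  simp only [dPPolynomial, Matrix.add_apply, C_add, add_mul, Finset.sum_add_distrib, mul_add]

theorem coeff_dPPolynomial_smul (r : ℕ) (a : ℝ) (A : Matrix (Fin k) (Fin k) ℝ) (d : Fin k →₀ ℕ) :
    coeff d (dPPolynomial r (a • A)) = a * coeff d (dPPolynomial r A) := by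
  rw [← coeff_C_mul]
  congr 1
  simp only [dPPolynomial, Matrix.smul_apply, smul_eq_mul, C_mul, Finset.mul_sum]
  refine Finset.sum_congr rfl fun i _ => Finset.sum_congr rfl fun j _ => ?_
  ring

theorem add_mem_dPCone {r : ℕ} {A B : Matrix (Fin k) (Fin k) ℝ} (hA : A ∈ dPCone k r)
    (hB : B ∈ dPCone k r) : A + B ∈ dPCone k r :=
  ⟨hA.1.add hB.1, fun d => by
    change 0 ≤ coeff d (dPPolynomial r (A + B))
    rw [coeff_dPPolynomial_add]
    exact add_nonneg (hA.2 d) (hB.2 d)⟩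

theorem smul_mem_dPCone {r : ℕ} {A : Matrix (Fin k) (Fin k) ℝ} (hA : A ∈ dPCone k r) {a : ℝ}
    (ha : 0 ≤ a) : a • A ∈ dPCone k r :=
  ⟨hA.1.smul a, fun d => by
    change 0 ≤ coeff d (dPPolynomial r (a • A))
    rw [coeff_dPPolynomial_smul]
    exact mul_nonneg ha (hA.2 d)⟩

theorem isClosed_dPCone (k r : ℕ) : IsClosed (dPCone k r) := by
  have h : dPCone k r = {A | A.IsSymm} ∩ ⋂ d, {A | 0 ≤ coeff d (dPPolynomial r A)} := by
    ext A
    simp only [dPCone, dPPolynomial, Set.mem_ofPred_eq, Set.mem_inter_iff, Set.mem_iInter]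
  rw [h]
  refine (isClosed_eq continuous_id.matrix_transpose continuous_id).inter
    (isClosed_iInter fun d => isClosed_le continuous_const ?_)
  let f : Matrix (Fin k) (Fin k) ℝ →ₗ[ℝ] ℝ :=
    { toFun := fun A => coeff d (dPPolynomial r A)
      map_add' := fun A B => coeff_dPPolynomial_add r A B d
      map_smul' := fun a A => coeff_dPPolynomial_smul r a A d }
  exact f.continuous_of_finiteDimensional

end Polya

/-! ### Symmetric tensors and interior points -/

section Tensor

variable {V : Type*} [NormedAddCommGroup V] [InnerProductSpace ℝ V] {k : ℕ}

theorem tensorMatrix_isSymm (A : SymTensor V) (c : Fin k → V) :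
    (tensorMatrix (A : V ⊗[ℝ] V) c).IsSymm := by
  ext i j
  have hA : TensorProduct.comm ℝ V V (A : V ⊗[ℝ] V) = A := A.2
  simp only [tensorMatrix, Matrix.transpose_apply, Matrix.of_apply]
  conv_lhs => rw [← hA, ← TensorProduct.comm_tmul, TensorProduct.inner_comm_comm]

theorem tensorMatrix_add (A B : V ⊗[ℝ] V) (c : Fin k → V) :
    tensorMatrix (A + B) c = tensorMatrix A c + tensorMatrix B c := by
  ext i j
  simp [tensorMatrix, inner_add_left]

theorem tensorMatrix_smul (a : ℝ) (A : V ⊗[ℝ] V) (c : Fin k → V) :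
    tensorMatrix (a • A) c = a • tensorMatrix A c := by
  ext i j
  exact real_inner_smul_left A (c i ⊗ₜ[ℝ] c j) a

theorem continuous_tensorMatrix (c : Fin k → V) :
    Continuous fun A : V ⊗[ℝ] V => tensorMatrix A c :=
  continuous_matrix fun i j =>
    Continuous.inner (𝕜 := ℝ) (E := V ⊗[ℝ] V) continuous_id
      (continuous_const (y := c i ⊗ₜ[ℝ] c j))

theorem inner_tmul_sum_smul (A : V ⊗[ℝ] V) (c : Fin k → V) (a : Fin k → ℝ) :
    inner ℝ A ((∑ i, a i • c i) ⊗ₜ[ℝ] (∑ i, a i • c i)) =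
      ∑ i, ∑ j, tensorMatrix A c i j * (a i * a j) := by
  simp only [TensorProduct.sum_tmul, TensorProduct.tmul_sum, inner_sum]
  rw [Finset.sum_comm]
  refine Finset.sum_congr rfl fun i _ => Finset.sum_congr rfl fun j _ => ?_
  rw [TensorProduct.smul_tmul_smul, mul_comm (tensorMatrix A c i j)]
  exact real_inner_smul_right A (c i ⊗ₜ[ℝ] c j) (a i * a j)

/-- The symmetric tensor `x ⊗ x`. -/
noncomputable def symSquare (x : V) : SymTensor V :=
  ⟨x ⊗ₜ[ℝ] x, TensorProduct.comm_tmul ℝ V V x x⟩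

/-- An interior point of the copositive cone is bounded below by a multiple of the square of any
linear functional. -/
theorem exists_pos_le_of_mem_interior_copositiveCone {K : Set V} {A : SymTensor V}
    (hA : A ∈ interior (copositiveCone K)) (u : V) :
    ∃ ε : ℝ, 0 < ε ∧ ∀ x ∈ K, ε * (inner ℝ u x) ^ 2 ≤ inner ℝ (A : V ⊗[ℝ] V) (x ⊗ₜ[ℝ] x) := by
  -- Near `t = 0`, `A - t (u ⊗ u)` stays copositive; any small positive `t` serves as `ε`.
  have hcont : Continuous fun t : ℝ => A - t • symSquare u := by fun_prop
  have hev : ∀ᶠ t in nhds (0 : ℝ), A - t • symSquare u ∈ copositiveCone K := by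
    refine hcont.continuousAt.eventually_mem ?_
    simpa using mem_interior_iff_mem_nhds.1 hA
  obtain ⟨ε, hε, hε0⟩ := ((hev.filter_mono nhdsWithin_le_nhds).and
    (self_mem_nhdsWithin (s := Set.Ioi (0 : ℝ)))).exists
  refine ⟨ε, hε0, fun x hx => ?_⟩
  have h := hε x hx
  have h' : inner ℝ ((A - ε • symSquare u : SymTensor V) : V ⊗[ℝ] V) (x ⊗ₜ[ℝ] x) =
      inner ℝ (A : V ⊗[ℝ] V) (x ⊗ₜ[ℝ] x) - ε * (inner ℝ u x) ^ 2 := by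
    simp only [symSquare, Submodule.coe_sub, Submodule.coe_smul, inner_sub_left,
      real_inner_smul_left, TensorProduct.inner_tmul]
    ring
  rw [h'] at h
  linarith

end Tensor

/-! ### The inner approximation cones -/

namespace EuclideanJordanAlgebra

variable {E : Type*} [NormedAddCommGroup E] [InnerProductSpace ℝ E] (J : EuclideanJordanAlgebra E)

theorem isClosedConvexCone_innerCone (F : Set (Fin J.rank → E)) (r : ℕ) :
    IsClosedConvexCone (J.innerCone F r) := by
  have hsmul : ∀ a : ℝ, 0 ≤ a → ∀ A ∈ J.innerCone F r, a • A ∈ J.innerCone F r := by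
    intro a ha A hA
    simp only [innerCone, Set.mem_iInter, Set.mem_ofPred_eq] at hA ⊢
    intro c hc
    rw [Submodule.coe_smul, tensorMatrix_smul]
    exact smul_mem_dPCone (hA c hc) ha
  refine ⟨⟨0, ?_⟩, fun a ha => hsmul a ha.le, ?_, ?_⟩
  · simp only [innerCone, Set.mem_iInter, Set.mem_ofPred_eq]
    intro c _
    convert zero_mem_dPCone J.rank r
    ext i j
    simp [tensorMatrix]
  · intro A hA B hB a b ha hb _
    have hA' := hsmul a ha A hA
    have hB' := hsmul b hb B hB
    simp only [innerCone, Set.mem_iInter, Set.mem_ofPred_eq] at hA' hB' ⊢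
    intro c hc
    rw [Submodule.coe_add, tensorMatrix_add]
    exact add_mem_dPCone (hA' c hc) (hB' c hc)
  · exact isClosed_biInter fun c _ =>
      (isClosed_dPCone J.rank r).preimage ((continuous_tensorMatrix c).comp continuous_subtype_val)

theorem innerCone_subset_succ (F : Set (Fin J.rank → E)) (r : ℕ) :
    J.innerCone F r ⊆ J.innerCone F (r + 1) :=
  Set.iInter₂_mono fun _ _ _ hA => dPCone_subset_succ _ _ hA

variable {J} in
theorem IsCompleteSystem.sum_smul_mem_symmetricCone {ι : Type*} [Fintype ι] {c : ι → E}
    (hc : J.IsCompleteSystem c) {a : ι → ℝ} (ha : ∀ i, 0 ≤ a i) :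
    ∑ i, a i • c i ∈ J.symmetricCone := by
  classical
  refine ⟨∑ i, √(a i) • c i, ?_⟩
  rw [hc.mul_sum_smul]
  simp only [Real.mul_self_sqrt (ha _)]

/-- Every element of the symmetric cone is a nonnegative combination of the members of a frame
in a set which contains a reordering of each ordered Jordan frame. -/
theorem exists_nonneg_decomposition_of_mem_symmetricCone [FiniteDimensional ℝ E]
    {Fc : Set (Fin J.rank → E)} (hFc : J.IsCompleteSetOfFrames Fc) {x : E}
    (hx : x ∈ J.symmetricCone) :
    ∃ c ∈ Fc, ∃ a : Fin J.rank → ℝ, (∀ i, 0 ≤ a i) ∧ x = ∑ i, a i • c i := by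
  obtain ⟨y, rfl⟩ := hx
  obtain ⟨c, hc, a, rfl⟩ := J.exists_frame_decomposition y
  obtain ⟨_, ⟨hd, σ, rfl⟩, -⟩ := hFc.2 c hc
  refine ⟨_, hd, fun i => a (σ i) * a (σ i), fun i => mul_self_nonneg _, ?_⟩
  rw [(IsJordanFrame.isCompleteSystem hc).mul_sum_smul]
  exact (Equiv.sum_comp σ fun i => (a i * a i) • c i).symm

theorem innerCone_subset_copositiveCone [FiniteDimensional ℝ E] {Fc F : Set (Fin J.rank → E)}
    (hFc : J.IsCompleteSetOfFrames Fc) (hcF : Fc ⊆ F) (r : ℕ) :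
    J.innerCone F r ⊆ copositiveCone J.symmetricCone := by
  intro A hA x hx
  obtain ⟨c, hc, a, ha, rfl⟩ := J.exists_nonneg_decomposition_of_mem_symmetricCone hFc hx
  rw [inner_tmul_sum_smul]
  exact quadratic_nonneg_of_mem_dPCone (Set.mem_iInter₂.1 hA c (hcF hc)) ha

/-- The constants `ε`, `δ`, `B` do not involve the frame, so `r` is chosen before `c`. The
functional `⟪e, ·⟫` controls the sum of coefficients: `⟪e, c i⟫ = ‖c i‖² ≥ δ`. -/
theorem interior_copositiveCone_subset_iUnion_innerCone [FiniteDimensional ℝ E]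
    {F : Set (Fin J.rank → E)} (hF : F ⊆ J.orderedFrames) :
    interior (copositiveCone J.symmetricCone) ⊆ ⋃ r : ℕ, J.innerCone F r := by
  intro A hA
  obtain ⟨ε, hε, hA'⟩ := exists_pos_le_of_mem_interior_copositiveCone hA J.one
  obtain ⟨δ, hδ, hle⟩ := J.exists_le_norm_sq_of_isIdempotent
  set B : ℝ := ‖(A : E ⊗[ℝ] E)‖ * (‖J.one‖ * ‖J.one‖)
  obtain ⟨r, hr⟩ := exists_nat_ge (B / (ε * δ ^ 2))
  refine Set.mem_iUnion.2 ⟨r, Set.mem_iInter₂.2 fun c hc => ?_⟩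
  have hcs : J.IsCompleteSystem c := IsJordanFrame.isCompleteSystem (hF hc)
  refine mem_dPCone_of_le (tensorMatrix_isSymm A c) (μ := ε * δ ^ 2) (B := B) ?_ ?_ ?_
  · intro a ha
    rw [← inner_tmul_sum_smul]
    refine le_trans ?_ (hA' _ (hcs.sum_smul_mem_symmetricCone ha))
    have h : δ * ∑ i, a i ≤ inner ℝ J.one (∑ i, a i • c i) := by
      rw [inner_sum, Finset.mul_sum]
      refine Finset.sum_le_sum fun i _ => ?_
      rw [real_inner_smul_right, J.inner_one_idempotent (hcs.1 i).1, _root_.mul_comm]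
      exact mul_le_mul_of_nonneg_left (hle _ (hcs.1 i).1 (hcs.1 i).2) (ha i)
    have h0 : 0 ≤ δ * ∑ i, a i := mul_nonneg hδ.le (Finset.sum_nonneg fun i _ => ha i)
    rw [mul_assoc, ← mul_pow]
    exact mul_le_mul_of_nonneg_left (pow_le_pow_left₀ h0 h 2) hε.le
  · intro i
    change inner ℝ (A : E ⊗[ℝ] E) (c i ⊗ₜ[ℝ] c i) ≤ B
    refine (real_inner_le_norm (A : E ⊗[ℝ] E) (c i ⊗ₜ[ℝ] c i)).trans ?_
    rw [TensorProduct.norm_tmul]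
    have := (hcs.1 i).1.norm_le
    exact mul_le_mul_of_nonneg_left (mul_le_mul this this (norm_nonneg _) (norm_nonneg _))
      (norm_nonneg _)
  · have hμ : 0 < ε * δ ^ 2 := by positivity
    rw [div_le_iff₀' hμ] at hr
    exact hr.trans (mul_le_mul_of_nonneg_left (by linarith) hμ.le)

end EuclideanJordanAlgebra

theorem mainTheorem3 {E : Type*} [NormedAddCommGroup E] [InnerProductSpace ℝ E]
    [FiniteDimensional ℝ E] (J : EuclideanJordanAlgebra E)
    (Fc F : Set (Fin J.rank → E)) (hFc : J.IsCompleteSetOfFrames Fc)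
    (hcF : Fc ⊆ F) (hF : F ⊆ J.orderedFrames) :
    (∀ r : ℕ, IsClosedConvexCone (J.innerCone F r)) ∧
    (∀ r : ℕ, J.innerCone F r ⊆ J.innerCone F (r + 1) ∧
      J.innerCone F (r + 1) ⊆ copositiveCone J.symmetricCone) ∧
    interior (copositiveCone J.symmetricCone) ⊆ ⋃ r : ℕ, J.innerCone F r :=
  ⟨J.isClosedConvexCone_innerCone F,
    fun r => ⟨J.innerCone_subset_succ F r, J.innerCone_subset_copositiveCone hFc hcF (r + 1)⟩,
    J.interior_copositiveCone_subset_iUnion_innerCone hF⟩
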